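/- Let $d \ge 2$ and $k$ be natural numbers with $\frac{d}{2} \le k < d$. Then there exists a compact set $K \subseteq [0,1]^d$ such that $K$ intersects each $k$-dimensional affine subspace of $\mathbb{R}^d$ that meets $[0,1]^d$, but the sumset $K + K = \{x + y : x, y \in K\}$ is nowhere dense in $\mathbb{R}^d$. -/

import Mathlib

open scoped Pointwise

/-- The closed unit cube `[0,1]^d` in `ℝ^d`. -/
def unitCube (d : ℕ) : Set (EuclideanSpace ℝ (Fin d)) :=
  {x | ∀ i, x i ∈ Set.Icc (0 : ℝ) 1}

open Set Module

/-! `K` is a limit of perturbations of the union of the (d-k)-dimensional faces of the cube. Each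
stage is a family of compact sets `S I`, |I| = d-k, having finitely many possible values (heights)
in every coordinate outside `I`, such that every k-dimensional `V` meeting the cube hits some `S I`
transversally, with slopes at most `C / margin`. The faces themselves qualify
(`hitsWith_cubeFaces`).

The main step, `Admissible.exists_perturbation`, makes the sumset miss a point `p` of a given open
set. Take the coordinates of `p` off `D + D`, where `D` is the set of heights. If a coordinate lies
outside both `I` and `J`, then `S I + S J` still misses `p` after small changes of height. Since
2(d-k) ≤ d, only `J = Iᶜ` remains. There sums equal to `p` arise at finitely many places, where
holes are cut and refilled at other heights, so that no two pieces add up to `p`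
(`add_ne_of_doublePatch_of_singlePatch`). A subspace through a hole still hits the filling: at holes
the coordinates in `I` stay away from 0 and 1, so `margin` is bounded below and slopes are bounded.

Iterate over a countable basis, keeping thickenings so thin that each missed point stays missed. The
intersection meets every `V` by compactness, and `K + K` is closed with empty interior. -/

lemma isClosed_setOf_forall {X : Type*} [TopologicalSpace X] {α : Sort*} {P : α → X → Prop}
    (h : ∀ a, IsClosed {x | P a x}) : IsClosed {x | ∀ a, P a x} := by
  have : {x | ∀ a, P a x} = ⋂ a, {x | P a x} := by ext; simp
  exact this ▸ isClosed_iInter h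

lemma isClosed_setOf_exists_mem {X α : Type*} [TopologicalSpace X] {s : Finset α}
    {P : α → X → Prop} (h : ∀ a, IsClosed {x | P a x}) : IsClosed {x | ∃ a ∈ s, P a x} := by
  have : {x | ∃ a ∈ s, P a x} = ⋃ a ∈ s, {x | P a x} := by ext; simp
  exact this ▸ isClosed_biUnion_finset fun a _ => h a

/-! ### Faces of the cube and transversal intersection points -/

section CubeGeometry

variable {ι : Type*} [Fintype ι] [DecidableEq ι]

/-- The product of the distances of the coordinates in `I` to the endpoints of the unit interval. -/
def margin (I : Finset ι) (x : ι → ℝ) : ℝ := ∏ i ∈ I, x i * (1 - x i)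

omit [Fintype ι] [DecidableEq ι] in
lemma continuous_margin (I : Finset ι) : Continuous (margin I) := by
  unfold margin; fun_prop

omit [Fintype ι] [DecidableEq ι] in
lemma margin_le_one {I : Finset ι} {x : ι → ℝ} (hx : x ∈ Icc (0 : ι → ℝ) 1) : margin I x ≤ 1 := by
  refine Finset.prod_le_one (fun i _ => ?_) (fun i _ => ?_)
  · have := hx.1 i; have := hx.2 i; simp at *; nlinarith
  · have := hx.1 i; have := hx.2 i; simp at *; nlinarith

omit [Fintype ι] in
lemma margin_le_of_mem {I : Finset ι} {x : ι → ℝ} (hx : x ∈ Icc (0 : ι → ℝ) 1) {i : ι}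
    (hi : i ∈ I) : margin I x ≤ x i * (1 - x i) := by
  have h := margin_le_one (I := I.erase i) hx
  have h1 := hx.1 i
  have h2 := hx.2 i
  simp only [Pi.zero_apply, Pi.one_apply] at h1 h2
  unfold margin at *
  rw [← Finset.mul_prod_erase I _ hi]
  have : 0 ≤ x i * (1 - x i) := mul_nonneg h1 (by linarith)
  nlinarith

omit [DecidableEq ι] in
lemma exists_exit {x w : ι → ℝ} (hx : x ∈ Icc (0 : ι → ℝ) 1) (hw : w ≠ 0) :
    ∃ t : ℝ, 0 ≤ t ∧ x + t • w ∈ Icc (0 : ι → ℝ) 1 ∧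
      ∃ i, (0 < w i ∧ x i + t * w i = 1) ∨ (w i < 0 ∧ x i + t * w i = 0) := by
  obtain ⟨i₀, hi₀⟩ := Function.ne_iff.1 hw
  simp only [Pi.zero_apply] at hi₀
  let q : ι → ℝ := fun i => (if 0 < w i then 1 - x i else x i) / |w i|
  have hx0 : ∀ i, 0 ≤ x i := fun i => hx.1 i
  have hx1 : ∀ i, x i ≤ 1 := fun i => hx.2 i
  obtain ⟨i, hi, hmin⟩ := Finset.exists_min_image (Finset.univ.filter fun i => w i ≠ 0) q
    ⟨i₀, by simpa using hi₀⟩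
  simp only [Finset.mem_filter, Finset.mem_univ, true_and] at hi hmin
  have hq : ∀ l, w l ≠ 0 → (0 < w l ∧ q l * w l = 1 - x l) ∨ (w l < 0 ∧ q l * w l = - x l) := by
    intro l hl
    rcases lt_or_gt_of_ne hl with h | h
    · right
      refine ⟨h, ?_⟩
      simp only [q, if_neg h.not_gt, abs_of_neg h]
      field_simp
    · left
      refine ⟨h, ?_⟩
      simp only [q, if_pos h, abs_of_pos h]
      field_simp
  have hq0 : 0 ≤ q i := by
    refine div_nonneg ?_ (abs_nonneg _)
    split_ifs
    · linarith [hx1 i]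
    · exact hx0 i
  have key : ∀ l, 0 ≤ x l + q i * w l ∧ x l + q i * w l ≤ 1 := by
    intro l
    by_cases hl : w l = 0
    · rw [hl]; simpa using ⟨hx0 l, hx1 l⟩
    · have := hmin l hl
      rcases hq l hl with ⟨h, h'⟩ | ⟨h, h'⟩
      · constructor
        · have := hx0 l; positivity
        · nlinarith
      · constructor
        · nlinarith
        · nlinarith [hx1 l]
  refine ⟨q i, hq0, ⟨fun l => (key l).1, fun l => (key l).2⟩, i, ?_⟩
  rcases hq i hi with ⟨h, h'⟩ | ⟨h, h'⟩
  · left; exact ⟨h, by linarith⟩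
  · right; exact ⟨h, by linarith⟩

/-- `f` is the vector of `W` dual to the coordinate `j` among the coordinates outside `I`. -/
def IsDual (W : Submodule ℝ (ι → ℝ)) (I : Finset ι) (j : ι) (f : ι → ℝ) : Prop :=
  f ∈ W ∧ f j = 1 ∧ ∀ l ∉ I, l ≠ j → f l = 0

omit [Fintype ι] in
-- Basis exchange as in the simplex method: subtracting `f i • w` clears coordinate `i`, which has
-- just left `I`.
lemma IsDual.pivot {W : Submodule ℝ (ι → ℝ)} {I : Finset ι} {i : ι} (hi : i ∈ I) {w : ι → ℝ}
    (hw : IsDual W (I.erase i) i w) {j : ι} (hj : j ∉ I) {f : ι → ℝ} (hf : IsDual W I j f) :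
    IsDual W (I.erase i) j (f - f i • w) := by
  have hij : i ≠ j := fun h => hj (h ▸ hi)
  refine ⟨W.sub_mem hf.1 (W.smul_mem _ hw.1), ?_, fun l hl hlj => ?_⟩
  · have := hw.2.2 j (by simp [hj]) hij.symm
    simp [this, hf.2.1]
  · by_cases hli : l = i
    · subst hli; simp [hw.2.1]
    · have h1 := hw.2.2 l hl hli
      have h2 := hf.2.2 l (by simpa [hli] using hl) hlj
      simp [h1, h2]

/-- While only `r < dim V` coordinates are frozen at 0 or 1, some nonzero direction of `V` keeps
them fixed. Following it until it exits the cube freezes one more coordinate, and a pivot updates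
the dual vectors. -/
lemma exists_vertex_aux (V : AffineSubspace ℝ (ι → ℝ))
    (hV : ((V : Set (ι → ℝ)) ∩ Icc 0 1).Nonempty) (r : ℕ) (hr : r ≤ finrank ℝ V.direction) :
    ∃ I : Finset ι, I.card + r = Fintype.card ι ∧ ∃ x ∈ V, x ∈ Icc (0 : ι → ℝ) 1 ∧
      (∀ j ∉ I, x j = 0 ∨ x j = 1) ∧ ∀ j ∉ I, ∃ f, IsDual V.direction I j f := by
  induction r with
  | zero =>
    obtain ⟨x, hxV, hx⟩ := hV
    exact ⟨Finset.univ, by simp, x, hxV, hx, by simp, by simp⟩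
  | succ r ih =>
    obtain ⟨I, hI, x, hxV, hx, hx01, hdual⟩ := ih (by omega)
    obtain ⟨w, hw0, hwV, hwI⟩ : ∃ w : ι → ℝ, w ≠ 0 ∧ w ∈ V.direction ∧ ∀ j ∉ I, w j = 0 := by
      let φ : V.direction →ₗ[ℝ] ({j // j ∉ I} → ℝ) :=
        LinearMap.pi fun j => (LinearMap.proj j.1).comp V.direction.subtype
      have hcard : Fintype.card {j // j ∉ I} = r := by
        rw [Fintype.card_subtype_compl]; simp; omega
      have : LinearMap.ker φ ≠ ⊥ := by
        apply LinearMap.ker_ne_bot_of_finrank_lt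
        rw [finrank_fintype_fun_eq_card, hcard]; omega
      obtain ⟨w, hw, hw0⟩ := Submodule.exists_mem_ne_zero_of_ne_bot this
      refine ⟨w, by simpa using hw0, w.2, fun j hj => ?_⟩
      exact congrFun (LinearMap.mem_ker.1 hw) ⟨j, hj⟩
    obtain ⟨t, -, hxt, i, hi⟩ := exists_exit hx hw0
    have hwi : w i ≠ 0 := by rcases hi with h | h <;> [exact h.1.ne'; exact h.1.ne]
    have hiI : i ∈ I := by by_contra h; exact hwi (hwI i h)
    have hd : IsDual V.direction (I.erase i) i ((w i)⁻¹ • w) := by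
      refine ⟨V.direction.smul_mem _ hwV, by simp [hwi], fun l hl hli => ?_⟩
      simp [hwI l (by simpa [hli] using hl)]
    refine ⟨I.erase i, ?_, x + t • w, ?_, hxt, fun j hj => ?_, fun j hj => ?_⟩
    · have := Finset.card_erase_add_one hiI; omega
    · rw [add_comm]; exact V.vadd_mem_of_mem_direction (V.direction.smul_mem _ hwV) hxV
    · by_cases hji : j = i
      · subst hji
        rcases hi with h | h
        · right; simpa using h.2
        · left; simpa using h.2
      · have hjI : j ∉ I := by simpa [hji] using hj
        simpa [hwI j hjI] using hx01 j hjI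
    · by_cases hji : j = i
      · subst hji; exact ⟨_, hd⟩
      · have hjI : j ∉ I := by simpa [hji] using hj
        obtain ⟨f, hf⟩ := hdual j hjI
        exact ⟨_, hd.pivot hiI hjI hf⟩

/-- Every `k`-dimensional affine subspace meeting the cube meets some `S I`, at a point where it is
transversal to the coordinate subspace of `I` with a bound on the slope in terms of the margin. -/
def HitsWith (k : ℕ) (C : ℝ) (S : Finset ι → Set (ι → ℝ)) : Prop :=
  ∀ V : AffineSubspace ℝ (ι → ℝ), finrank ℝ V.direction = k →
    ((V : Set (ι → ℝ)) ∩ Icc 0 1).Nonempty →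
    ∃ I : Finset ι, I.card + k = Fintype.card ι ∧ ∃ x ∈ S I, x ∈ V ∧
      ∀ j ∉ I, ∃ f, IsDual V.direction I j f ∧ ∀ i ∈ I, margin I x * |f i| ≤ C

/-- The points of the cube all of whose coordinates outside `I` are `0` or `1`. -/
def cubeFaces (I : Finset ι) : Set (ι → ℝ) :=
  {x | x ∈ Icc (0 : ι → ℝ) 1 ∧ ∀ j ∉ I, x j ∈ ({0, 1} : Set ℝ)}

omit [Fintype ι] [DecidableEq ι] in
lemma isCompact_cubeFaces (I : Finset ι) : IsCompact (cubeFaces I) := by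
  refine isCompact_Icc.of_isClosed_subset ?_ (fun x hx => hx.1)
  refine isClosed_Icc.inter ?_
  exact isClosed_setOf_forall fun j => isClosed_setOf_forall fun _ =>
    (Set.toFinite ({0, 1} : Set ℝ)).isClosed.preimage (continuous_apply j)

/-- Choose the pair `(I, x)` of least margin. If a slope exceeded `1 / margin`, moving coordinate
`j` inward along `f` would reach the boundary at a time `t < margin`, in some coordinate `i ∈ I`.
Exchanging `i` and `j` gives a competitor whose free coordinate `j` is at distance `t` from an
endpoint, so its margin is at most `t`. -/
lemma hitsWith_cubeFaces (k : ℕ) : HitsWith k 1 (cubeFaces (ι := ι)) := by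
  intro V hk hV
  let 𝓘 : Set (Finset ι) :=
    {I | I.card + k = Fintype.card ι ∧ ∀ j ∉ I, ∃ f, IsDual V.direction I j f}
  let M : Set ℝ := ⋃ I ∈ 𝓘, margin I '' ((V : Set (ι → ℝ)) ∩ cubeFaces I)
  have hM : IsCompact M := (Set.toFinite 𝓘).isCompact_biUnion fun I _ =>
    ((isCompact_cubeFaces I).inter_left V.closed_of_finiteDimensional).image (continuous_margin I)
  obtain ⟨I₀, hI₀, x₀, hx₀V, hx₀, hx₀1, hd₀⟩ := exists_vertex_aux V hV k hk.ge
  have hne : M.Nonempty :=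
    ⟨_, mem_biUnion (show I₀ ∈ 𝓘 from ⟨hI₀, hd₀⟩) ⟨x₀, ⟨hx₀V, hx₀, fun j hj => by
      simpa using hx₀1 j hj⟩, rfl⟩⟩
  obtain ⟨_, hmem, hleast⟩ := hM.exists_isLeast hne
  obtain ⟨I, hI, x, ⟨hxV, hx, hx01⟩, rfl⟩ := mem_iUnion₂.1 hmem
  refine ⟨I, hI.1, x, ⟨hx, hx01⟩, hxV, fun j hj => ?_⟩
  obtain ⟨f, hf⟩ := hI.2 j hj
  refine ⟨f, hf, fun i₁ hi₁ => ?_⟩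
  by_contra! hlarge
  have hx0 : ∀ i, 0 ≤ x i := fun i => hx.1 i
  have hx1 : ∀ i, x i ≤ 1 := fun i => hx.2 i
  have hmpos : 0 < margin I x := by
    by_contra! h
    have := mul_nonpos_of_nonpos_of_nonneg h (abs_nonneg (f i₁))
    linarith
  have hint : ∀ i ∈ I, x i ≠ 0 ∧ x i ≠ 1 := by
    intro i hi
    have := margin_le_of_mem hx hi
    constructor <;> intro h <;> rw [h] at this <;> norm_num at this <;> linarith
  have hm1 : margin I x ≤ 1 / 4 := by
    have := margin_le_of_mem hx hi₁
    nlinarith [sq_nonneg (x i₁ - 1 / 2)]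
  obtain ⟨σ, hσ⟩ : ∃ σ : ℝ, (σ = 1 ∧ x j = 0) ∨ (σ = -1 ∧ x j = 1) := by
    rcases hx01 j hj with h | h
    · exact ⟨1, Or.inl ⟨rfl, h⟩⟩
    · exact ⟨-1, Or.inr ⟨rfl, h⟩⟩
  have hσ1 : |σ| = 1 := by rcases hσ with h | h <;> simp [h.1]
  have hσ0 : σ ≠ 0 := by rintro rfl; simp at hσ1
  have hf0 : σ • f ≠ 0 := by
    intro h
    have := congrFun h j
    simp [hf.2.1, hσ0] at this
  obtain ⟨t, ht0, hxt, i, hi⟩ := exists_exit hx hf0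
  set y := x + t • σ • f with hy
  have hyl : ∀ l, y l = x l + t * (σ * f l) := fun l => by simp [hy]
  have hy0 : ∀ l, 0 ≤ y l := fun i => hxt.1 i
  have hy1 : ∀ l, y l ≤ 1 := fun i => hxt.2 i
  have ht1 : t * |f i₁| ≤ 1 := by
    have : t * |f i₁| = |y i₁ - x i₁| := by
      rw [hyl, add_sub_cancel_left, abs_mul, abs_mul, hσ1, abs_of_nonneg ht0]; ring
    rw [this, abs_le]
    constructor <;> linarith [hy0 i₁, hy1 i₁, hx0 i₁, hx1 i₁]
  have htm : t < margin I x := by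
    by_contra! h
    have := mul_le_mul_of_nonneg_right h (abs_nonneg (f i₁))
    linarith
  have hfi : f i ≠ 0 := by
    intro h; simp [h] at hi
  have hyi : y i = 0 ∨ y i = 1 := by
    rw [hyl]
    rcases hi with h | h
    · right; simpa using h.2
    · left; simpa using h.2
  -- An exit through `j` itself would need `t = 1`, but `t < margin I x ≤ 1 / 4`.
  have hij : i ≠ j := by
    rintro rfl
    rw [hyl, hf.2.1] at hyi
    rcases hσ with ⟨rfl, h⟩ | ⟨rfl, h⟩
    · simp only [Pi.smul_apply, smul_eq_mul, hf.2.1] at hi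
      rcases hi with hi | hi <;> linarith
    · simp only [Pi.smul_apply, smul_eq_mul, hf.2.1] at hi
      rcases hi with hi | hi <;> linarith
  have hiI : i ∈ I := by by_contra h; exact hfi (hf.2.2 i h hij)
  have hyj : y j = t ∨ 1 - y j = t := by
    rw [hyl, hf.2.1]
    rcases hσ with ⟨rfl, h⟩ | ⟨rfl, h⟩
    · left; linarith
    · right; linarith
  -- exchange `i` and `j`
  let I' := (insert j I).erase i
  have hjI' : j ∈ I' := by simp [I', hij.symm]
  have hI'mem : ∀ l, l ∉ I' → l = i ∨ (l ∉ I ∧ l ≠ j) := by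
    intro l hl
    by_cases h : l = i
    · exact Or.inl h
    · right; simp only [I', Finset.mem_erase, Finset.mem_insert, not_and, not_or] at hl
      exact ⟨(hl h).2, (hl h).1⟩
  have hw : IsDual V.direction I' i ((f i)⁻¹ • f) := by
    refine ⟨V.direction.smul_mem _ hf.1, by simp [hfi], fun l hl hli => ?_⟩
    rcases hI'mem l hl with h | h
    · exact absurd h hli
    · simp [hf.2.2 l h.1 h.2]
  have hI' : I' ∈ 𝓘 := by
    constructor
    · have h1 : (insert j I).card = I.card + 1 := Finset.card_insert_of_notMem hj
      have h2 : I'.card + 1 = (insert j I).card :=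
        Finset.card_erase_add_one (by simp [hiI])
      have := hI.1
      omega
    · intro l hl
      rcases hI'mem l hl with h | h
      · subst h; exact ⟨_, hw⟩
      · obtain ⟨g, hg⟩ := hI.2 l h.1
        refine ⟨_, hw.pivot (by simp [hiI]) (by simpa [not_or] using h.symm)
          ⟨hg.1, hg.2.1, fun l' hl' hne => ?_⟩⟩
        exact hg.2.2 l' (fun h => hl' (by simp [h])) hne
  have hyface : y ∈ cubeFaces I' := by
    refine ⟨hxt, fun l hl => ?_⟩
    rcases hI'mem l hl with h | h
    · subst h; simpa using hyi
    · have := hx01 l h.1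
      rw [hyl, hf.2.2 l h.1 h.2]
      simpa using this
  have hyV : y ∈ V := by
    rw [hy, add_comm]
    exact V.vadd_mem_of_mem_direction
      (V.direction.smul_mem _ (V.direction.smul_mem _ hf.1)) hxV
  have hle := hleast (mem_biUnion hI' ⟨y, ⟨hyV, hyface⟩, rfl⟩)
  have hmy := margin_le_of_mem hxt hjI'
  have : y j * (1 - y j) ≤ t := by
    rcases hyj with h | h <;> nlinarith [hy0 j, hy1 j]
  linarith

end CubeGeometry

/-! ### Cutting and refilling holes -/

section Perturbation

variable {ι : Type*} [Fintype ι] [DecidableEq ι]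

/-- The sign of the direction in which `t` can be moved by up to `1 / 2` inside `[0, 1]`. -/
noncomputable def inwardSign (t : ℝ) : ℝ := if t < 1 / 2 then 1 else -1

/-- `t` moved by `z` towards the farther endpoint of `[0, 1]`. -/
noncomputable def shiftIn (z t : ℝ) : ℝ := t + inwardSign t * z

lemma abs_inwardSign (t : ℝ) : |inwardSign t| = 1 := by
  unfold inwardSign; split_ifs <;> simp

lemma abs_shiftIn_sub {z : ℝ} (hz : 0 ≤ z) (t : ℝ) : |shiftIn z t - t| = z := by
  rw [shiftIn, add_sub_cancel_left, abs_mul, abs_inwardSign, one_mul, abs_of_nonneg hz]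

lemma shiftIn_mem {z t : ℝ} (hz : 0 ≤ z) (hz2 : z ≤ 1 / 2) (ht : t ∈ Icc (0 : ℝ) 1) :
    shiftIn z t ∈ Icc (0 : ℝ) 1 := by
  obtain ⟨h0, h1⟩ := ht
  unfold shiftIn inwardSign
  split_ifs <;> constructor <;> linarith

/-- Points whose coordinates outside `I` lie in `D`, except that the one at `a` lies in `D` shifted
by `z`. -/
def shiftedLevels (I : Finset ι) (a : ι) (D : Finset ℝ) (z : ℝ) : Set (ι → ℝ) :=
  {x | x a ∈ D.image (shiftIn z) ∧ ∀ j, j ∉ I → j ≠ a → x j ∈ D}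

/-- Points `x` for which every coordinate in `I` of `p - x` is close to `E`. -/
def nearLevels (p : ι → ℝ) (I : Finset ι) (E : ι → Finset ℝ) (ρ : ℝ) : Set (ι → ℝ) :=
  {x | ∀ i, i ∈ I → ∃ t ∈ E i, |p i - x i - t| ≤ ρ}

/-- Points `x` for which some coordinate in `I` of `p - x` is far from `E`. -/
def farLevels (p : ι → ℝ) (I : Finset ι) (E : ι → Finset ℝ) (ρ : ℝ) : Set (ι → ℝ) :=
  {x | ∃ i ∈ I, ∀ t, t ∈ E i → ρ ≤ |p i - x i - t|}

/-- The modification that cuts holes into `S` and fills each by a ball and an annulus, at two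
different heights. -/
def doublePatch (I : Finset ι) (a : ι) (D : Finset ℝ) (p : ι → ℝ) (h ε r : ℝ)
    (S : Set (ι → ℝ)) : Set (ι → ℝ) :=
  S ∩ farLevels p I (fun _ => D) r ∪
    (shiftedLevels I a D h ∩ nearLevels p I (fun _ => D) ε ∪
      shiftedLevels I a D (2 * h) ∩ farLevels p I (fun _ => D) ε)

/-- The heights of the balls in `doublePatch`. -/
noncomputable def ballHeights (D : Finset ℝ) (h : ℝ) (b : ι) : ι → Finset ℝ :=
  Function.update (fun _ => D) b (D.image (shiftIn h))

/-- The modification that cuts holes into `S` and fills each by a ball at a different height. -/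
def singlePatch (I : Finset ι) (a b : ι) (D : Finset ℝ) (p : ι → ℝ) (h κ ρ r : ℝ)
    (S : Set (ι → ℝ)) : Set (ι → ℝ) :=
  S ∩ farLevels p I (ballHeights D h b) r ∪
    shiftedLevels I a D κ ∩ nearLevels p I (ballHeights D h b) ρ

omit [Fintype ι] [DecidableEq ι] in
lemma isClosed_shiftedLevels (I : Finset ι) (a : ι) (D : Finset ℝ) (z : ℝ) :
    IsClosed (shiftedLevels I a D z) := by
  have ha : IsClosed {x : ι → ℝ | x a ∈ D.image (shiftIn z)} :=
    (D.image (shiftIn z)).finite_toSet.isClosed.preimage (continuous_apply a)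
  refine ha.inter ?_
  exact isClosed_setOf_forall fun j => isClosed_setOf_forall fun _ => isClosed_setOf_forall fun _ =>
    D.finite_toSet.isClosed.preimage (continuous_apply j)

omit [Fintype ι] [DecidableEq ι] in
lemma isClosed_nearLevels (p : ι → ℝ) (I : Finset ι) (E : ι → Finset ℝ) (ρ : ℝ) :
    IsClosed (nearLevels p I E ρ) :=
  isClosed_setOf_forall fun i => isClosed_setOf_forall fun _ => isClosed_setOf_exists_mem fun t =>
    isClosed_le (by fun_prop) continuous_const

omit [Fintype ι] [DecidableEq ι] in
lemma isClosed_farLevels (p : ι → ℝ) (I : Finset ι) (E : ι → Finset ℝ) (ρ : ℝ) :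
    IsClosed (farLevels p I E ρ) :=
  isClosed_setOf_exists_mem fun i => isClosed_setOf_forall fun t => isClosed_setOf_forall fun _ =>
    isClosed_le continuous_const (by fun_prop)

omit [Fintype ι] [DecidableEq ι] in
lemma isClosed_doublePatch {I : Finset ι} {a : ι} {D : Finset ℝ} {p : ι → ℝ} {h ε r : ℝ}
    {S : Set (ι → ℝ)} (hS : IsClosed S) : IsClosed (doublePatch I a D p h ε r S) :=
  (hS.inter (isClosed_farLevels ..)).union
    (((isClosed_shiftedLevels ..).inter (isClosed_nearLevels ..)).union
      ((isClosed_shiftedLevels ..).inter (isClosed_farLevels ..)))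

omit [Fintype ι] in
lemma isClosed_singlePatch {I : Finset ι} {a b : ι} {D : Finset ℝ} {p : ι → ℝ} {h κ ρ r : ℝ}
    {S : Set (ι → ℝ)} (hS : IsClosed S) : IsClosed (singlePatch I a b D p h κ ρ r S) :=
  (hS.inter (isClosed_farLevels ..)).union
    ((isClosed_shiftedLevels ..).inter (isClosed_nearLevels ..))

/-- The elements of `D` are `δ`-separated. -/
def Separated (D : Finset ℝ) (δ : ℝ) : Prop := ∀ s ∈ D, ∀ t ∈ D, s ≠ t → δ ≤ |s - t|

lemma Separated.abs_le_abs {D : Finset ℝ} {δ : ℝ} (hD : Separated D δ) {s t z : ℝ} (hs : s ∈ D)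
    (ht : t ∈ D) (hz : |z| ≤ δ / 2) : |z| ≤ |s + z - t| := by
  by_cases h : s = t
  · subst h; simp
  · have h1 := hD s hs t ht h
    have h2 : |s - t| ≤ |s + z - t| + |z| := by
      have := abs_sub (s + z - t) z
      rwa [show s + z - t - z = s - t by ring] at this
    linarith

lemma Separated.le_abs_shiftIn_sub {D : Finset ℝ} {δ : ℝ} (hD : Separated D δ) {s t z : ℝ}
    (hs : s ∈ D) (ht : t ∈ D) (hz0 : 0 ≤ z) (hz : z ≤ δ / 2) : z ≤ |shiftIn z s - t| := by
  have h : |inwardSign s * z| = z := by rw [abs_mul, abs_inwardSign, one_mul, abs_of_nonneg hz0]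
  have := hD.abs_le_abs hs ht (z := inwardSign s * z) (by rwa [h])
  rwa [h] at this

lemma Separated.le_abs_shiftIn_sub_shiftIn {D : Finset ℝ} {δ : ℝ} (hD : Separated D δ)
    {s t z : ℝ} (hs : s ∈ D) (ht : t ∈ D) (hz0 : 0 ≤ z) (hz : z ≤ δ / 4) :
    z ≤ |shiftIn (2 * z) s - shiftIn z t| := by
  by_cases h : s = t
  · subst h
    rw [shiftIn, shiftIn, show s + inwardSign s * (2 * z) - (s + inwardSign s * z)
      = inwardSign s * z by ring, abs_mul, abs_inwardSign, one_mul, abs_of_nonneg hz0]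
  · have h1 := hD s hs t ht h
    have h2 := abs_shiftIn_sub (z := 2 * z) (by linarith) s
    have h3 := abs_shiftIn_sub hz0 t
    rw [abs_eq (by linarith)] at h2 h3
    rcases le_abs.1 h1 with h1 | h1 <;> rw [le_abs] <;>
      rcases h2 with h2 | h2 <;> rcases h3 with h3 | h3 <;>
      first
      | (left; linarith)
      | (right; linarith)

/-- If `y` lies in the cut `T`, its `I`-coordinates are in `D`, which excludes the cut `S` and the
annulus for `x`; the ball is excluded because its heights are those avoided by `T`. If `y` lies in
the refill at height `κ`, then `x a` is within `ρ < h` of height `h`, which excludes heights `0` and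
`2 * h`; the ball at height `h` is excluded because `y b` is at least `κ > ε` from `D`. -/
lemma add_ne_of_doublePatch_of_singlePatch {I : Finset ι} {a b : ι} (ha : a ∉ I) (hb : b ∈ I)
    {D : Finset ℝ} {δ : ℝ} (hD : Separated D δ) {p : ι → ℝ} {h ε r κ ρ r' : ℝ}
    {S T : Set (ι → ℝ)}
    (hT : ∀ y ∈ T, ∀ i ∈ I, y i ∈ D)
    (hS : ∀ x ∈ S, ∀ j, j ∉ I → x j ∈ D)
    (hr : 0 < r) (hr' : 0 < r') (hε : 0 < ε) (hεκ : ε < κ) (hκ : κ ≤ δ / 2) (hρ : ρ < h)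
    (hh0 : 0 ≤ h) (hh : h ≤ δ / 4) {x y : ι → ℝ} (hx : x ∈ doublePatch I a D p h ε r S)
    (hy : y ∈ singlePatch Iᶜ b a D p h κ ρ r' T) : x + y ≠ p := by
  intro hxy
  have hpx : ∀ i, p i - x i = y i := fun i => by rw [← hxy]; simp
  have hpy : ∀ i, p i - y i = x i := fun i => by rw [← hxy]; simp
  have haE : ballHeights D h a a = D.image (shiftIn h) := by simp [ballHeights]
  have hjE : ∀ j, j ≠ a → ballHeights D h a j = D := fun j hj => by simp [ballHeights, hj]
  simp only [doublePatch, singlePatch, farLevels, nearLevels, shiftedLevels, mem_union, mem_inter_iff,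
    mem_ofPred_eq, hpx, hpy, Finset.mem_compl, not_not] at hx hy
  rcases hy with ⟨hyT, j, hj, hjfar⟩ | ⟨⟨hyb, hyI⟩, hynear⟩
  · rcases hx with ⟨hxS, i, hi, hifar⟩ | ⟨⟨hxa, hxJ⟩, hxnear⟩ | ⟨⟨hxa, hxJ⟩, i, hi, hifar⟩
    · have := hifar _ (hT y hyT i hi)
      simp at this; linarith
    · have : x j ∈ ballHeights D h a j := by
        by_cases hja : j = a
        · subst hja; rwa [haE]
        · rw [hjE j hja]; exact hxJ j hj hja
      have := hjfar _ this
      simp at this; linarith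
    · have := hifar _ (hT y hyT i hi)
      simp at this; linarith
  · obtain ⟨t, ht, hxt⟩ := hynear a ha
    rw [haE, Finset.mem_image] at ht
    obtain ⟨t, ht, rfl⟩ := ht
    rcases hx with ⟨hxS, i, hi, hifar⟩ | ⟨⟨hxa, hxJ⟩, hxnear⟩ | ⟨⟨hxa, hxJ⟩, i, hi, hifar⟩
    · have := hD.le_abs_shiftIn_sub ht (hS x hxS a ha) hh0 (by linarith)
      rw [abs_sub_comm] at this
      linarith
    · obtain ⟨s, hs, hys⟩ := hxnear b hb
      obtain ⟨s', hs', hs'y⟩ := Finset.mem_image.1 hyb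
      rw [← hs'y] at hys
      have := hD.le_abs_shiftIn_sub hs' hs (by linarith) hκ
      linarith
    · obtain ⟨s', hs', hs'x⟩ := Finset.mem_image.1 hxa
      rw [← hs'x] at hxt
      have := hD.le_abs_shiftIn_sub_shiftIn hs' ht hh0 hh
      linarith

/-- A point moved along a dual vector stays in the cube and changes its level as expected. -/
lemma shift_spec {V : AffineSubspace ℝ (ι → ℝ)} {I : Finset ι} {a : ι} {f x : ι → ℝ} {L z δ η : ℝ}
    {D : Finset ℝ} {S : Set (ι → ℝ)} (haI : a ∉ I) (hxS : x ∈ S)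
    (hx : x ∈ Icc (0 : ι → ℝ) 1) (hxD : ∀ j, j ∉ I → x j ∈ D) (hxV : x ∈ V)
    (hf : IsDual V.direction I a f)
    (hL : ∀ i ∈ I, |f i| ≤ L) (hL1 : 1 ≤ L) (hz : 0 ≤ z) (hz2 : z ≤ 1 / 2) (hzL : z * L ≤ δ)
    (hzη : z * L ≤ η)
    (hint : ∀ i ∈ I, δ ≤ x i ∧ x i ≤ 1 - δ) :
    x + (inwardSign (x a) * z) • f ∈ V ∧
    x + (inwardSign (x a) * z) • f ∈ Icc (0 : ι → ℝ) 1 ∩ Metric.cthickening η S ∧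
    x + (inwardSign (x a) * z) • f ∈ shiftedLevels I a D z := by
  have hval : ∀ l, (x + (inwardSign (x a) * z) • f) l = x l + inwardSign (x a) * z * f l :=
    fun l => by simp
  have ha : (x + (inwardSign (x a) * z) • f) a = shiftIn z (x a) := by
    rw [hval, hf.2.1, shiftIn, mul_one]
  have hj : ∀ j, j ∉ I → j ≠ a → (x + (inwardSign (x a) * z) • f) j = x j := fun j hj hja => by
    rw [hval, hf.2.2 j hj hja]; simp
  have hd : ∀ l, |inwardSign (x a) * z * f l| ≤ z * L := by
    intro l
    rw [abs_mul, abs_mul, abs_inwardSign, one_mul, abs_of_nonneg hz]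
    refine mul_le_mul_of_nonneg_left ?_ hz
    by_cases hl : l ∈ I
    · exact hL l hl
    · by_cases hla : l = a
      · subst hla; rw [hf.2.1]; simpa using hL1
      · rw [hf.2.2 l hl hla]; simp; linarith
  have hcube : ∀ l, (x + (inwardSign (x a) * z) • f) l ∈ Icc (0 : ℝ) 1 := by
    intro l
    by_cases hl : l ∈ I
    · have h1 := hint l hl
      have h2 := abs_le.1 (hd l)
      rw [hval]
      constructor <;> linarith
    · by_cases hla : l = a
      · subst hla; rw [ha]; exact shiftIn_mem hz hz2 ⟨hx.1 l, hx.2 l⟩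
      · rw [hj l hl hla]; exact ⟨hx.1 l, hx.2 l⟩
  refine ⟨?_, ⟨⟨fun l => (hcube l).1, fun l => (hcube l).2⟩, ?_⟩, ?_, fun j hjI hja => ?_⟩
  · rw [add_comm]; exact V.vadd_mem_of_mem_direction (V.direction.smul_mem _ hf.1) hxV
  · refine Metric.mem_cthickening_of_dist_le _ x _ _ hxS ?_
    refine le_trans ?_ hzη
    refine (dist_pi_le_iff (by positivity)).2 fun l => ?_
    rw [hval, Real.dist_eq, add_sub_cancel_left]
    exact hd l
  · rw [ha]; exact Finset.mem_image_of_mem _ (hxD a haI)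
  · rw [hj j hjI hja]; exact hxD j hjI

end Perturbation

/-! ### Subspaces still hit the patched sets -/

section Hitting

variable {ι : Type*} [Fintype ι] [DecidableEq ι]

/-- No coordinate of `p` is within less than `δ` of `D + D`. -/
def AvoidsSums (p : ι → ℝ) (D : Finset ℝ) (δ : ℝ) : Prop :=
  ∀ i, ∀ s ∈ D, ∀ t ∈ D, δ ≤ |p i - s - t|

omit [Fintype ι] [DecidableEq ι] in
-- Since 0 and 1 are in `D`, a `u` too close to either would bring `p i` within less than `δ` of `D
-- + D`.
lemma AvoidsSums.interior {p : ι → ℝ} {D : Finset ℝ} {δ : ℝ} (hp : AvoidsSums p D δ)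
    (h0 : (0 : ℝ) ∈ D) (h1 : (1 : ℝ) ∈ D) {i : ι} {u s : ℝ} (hu : u ∈ Icc (0 : ℝ) 1)
    (hs : s ∈ D) (hus : |p i - u - s| ≤ δ / 2) : δ / 2 ≤ u ∧ u ≤ 1 - δ / 2 := by
  have hp0 := hp i s hs 0 h0
  have hp1 := hp i s hs 1 h1
  have h := abs_le.1 hus
  obtain ⟨hu0, hu1⟩ := hu
  constructor
  · rcases le_abs.1 hp0 with hp0 | hp0 <;> linarith
  · rcases le_abs.1 hp1 with hp1 | hp1 <;> linarith

omit [DecidableEq ι] in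
lemma le_margin {I : Finset ι} {x : ι → ℝ} {δ : ℝ} (hδ : 0 ≤ δ) (hδ1 : δ ≤ 1)
    (hx : ∀ i ∈ I, δ ≤ x i ∧ x i ≤ 1 - δ) : (δ ^ 2) ^ Fintype.card ι ≤ margin I x := by
  calc (δ ^ 2) ^ Fintype.card ι ≤ (δ ^ 2) ^ I.card :=
        pow_le_pow_of_le_one (by positivity) (by nlinarith) (Finset.card_le_univ I)
    _ = ∏ i ∈ I, δ ^ 2 := by simp
    _ ≤ margin I x := by
        refine Finset.prod_le_prod (fun _ _ => by positivity) fun i hi => ?_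
        have := hx i hi
        nlinarith

variable {V : AffineSubspace ℝ (ι → ℝ)} {I : Finset ι} {a : ι} {D : Finset ℝ} {S : Set (ι → ℝ)}
  {p x f : ι → ℝ} {δ η C L h ε r κ ρ r' : ℝ}

omit [DecidableEq ι] in
lemma slope_le_of_interior (hδ : 0 < δ) (hδ1 : δ ≤ 1)
    (hC : C ≤ L * ((δ / 2) ^ 2) ^ Fintype.card ι)
    (hfC : ∀ i ∈ I, margin I x * |f i| ≤ C)
    (hint : ∀ i ∈ I, δ / 2 ≤ x i ∧ x i ≤ 1 - δ / 2) {i : ι} (hi : i ∈ I) : |f i| ≤ L := by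
  have hm := le_margin (by positivity) (by linarith) hint
  have hpos : 0 < ((δ / 2) ^ 2) ^ Fintype.card ι := by positivity
  have := hfC i hi
  have h2 := mul_le_mul_of_nonneg_right hm (abs_nonneg (f i))
  refine le_of_mul_le_mul_right ?_ hpos
  linarith

/-- At height `h` the subspace either meets the ball or has drifted by `|e| > ε - r` in some
coordinate. In the latter case the drift at height `2 * h` doubles, leaving distance over `2 * (ε -
r) - r ≥ ε` from `D`, so it meets the annulus. -/
lemma exists_mem_doublePatch (haI : a ∉ I) (h0 : (0 : ℝ) ∈ D) (h1 : (1 : ℝ) ∈ D)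
    (hD : Separated D δ) (hp : AvoidsSums p D δ) (hδ : 0 < δ) (hδ1 : δ ≤ 1)
    (hC : C ≤ L * ((δ / 2) ^ 2) ^ Fintype.card ι) (hL1 : 1 ≤ L)
    (hh0 : 0 < h) (hhδ : 2 * h * L ≤ δ / 4) (hhη : 2 * h * L ≤ η)
    (hrε : 3 * r ≤ ε) (hr : r ≤ δ / 4)
    (hxS : x ∈ S) (hx : x ∈ Icc (0 : ι → ℝ) 1) (hxD : ∀ j, j ∉ I → x j ∈ D) (hxV : x ∈ V)
    (hf : IsDual V.direction I a f) (hfC : ∀ i ∈ I, margin I x * |f i| ≤ C) :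
    ∃ y ∈ V, y ∈ (Icc (0 : ι → ℝ) 1 ∩ Metric.cthickening η S) ∩ doublePatch I a D p h ε r S ∧
      (y = x ∨ ∀ i ∈ I, δ / 2 ≤ x i ∧ x i ≤ 1 - δ / 2) := by
  by_cases hfar : x ∈ farLevels p I (fun _ => D) r
  · exact ⟨x, hxV, ⟨⟨hx, Metric.self_subset_cthickening S hxS⟩, Or.inl ⟨hxS, hfar⟩⟩, Or.inl rfl⟩
  have hnear : ∀ i ∈ I, ∃ s ∈ D, |p i - x i - s| < r := by
    simpa [farLevels] using hfar
  have hint : ∀ i ∈ I, δ / 2 ≤ x i ∧ x i ≤ 1 - δ / 2 := fun i hi => by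
    obtain ⟨s, hs, hsr⟩ := hnear i hi
    exact hp.interior (i := i) h0 h1 ⟨hx.1 i, hx.2 i⟩ hs (by linarith)
  have hL : ∀ i ∈ I, |f i| ≤ L := fun i hi => slope_le_of_interior hδ hδ1 hC hfC hint hi
  have hhL : h ≤ h * L := le_mul_of_one_le_right hh0.le hL1
  obtain ⟨hV1, hK1, hlev1⟩ := shift_spec (η := η) haI hxS hx hxD hxV hf hL hL1 hh0.le (by linarith)
    (by linarith) (by linarith) hint
  obtain ⟨hV2, hK2, hlev2⟩ := shift_spec (z := 2 * h) (η := η) haI hxS hx hxD hxV hf hL hL1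
    (by linarith) (by linarith) (by linarith) (by linarith) hint
  by_cases hball : x + (inwardSign (x a) * h) • f ∈ nearLevels p I (fun _ => D) ε
  · exact ⟨_, hV1, ⟨hK1, Or.inr (Or.inl ⟨hlev1, hball⟩)⟩, Or.inr hint⟩
  refine ⟨_, hV2, ⟨hK2, Or.inr (Or.inr ⟨hlev2, ?_⟩)⟩, Or.inr hint⟩
  obtain ⟨i, hi, hbig⟩ : ∃ i ∈ I, ∀ s ∈ D, ε < |p i - (x i + inwardSign (x a) * h * f i) - s| := by
    simpa [nearLevels] using hball
  refine ⟨i, hi, fun t ht => ?_⟩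
  obtain ⟨s, hs, hsr⟩ := hnear i hi
  set e := inwardSign (x a) * h * f i with he
  have hval : (x + (inwardSign (x a) * (2 * h)) • f) i = x i + 2 * e := by
    simp [he]; ring
  have hbig' := hbig s hs
  have h2e : |-(2 * e)| ≤ δ / 2 := by
    rw [abs_neg, abs_mul, he, abs_mul, abs_mul, abs_inwardSign, abs_of_pos hh0, abs_two]
    have := mul_le_mul_of_nonneg_left (hL i hi) hh0.le
    linarith
  have hle := hD.abs_le_abs hs ht h2e
  rw [abs_neg, abs_mul, abs_two] at hle
  have he' : ε - r < |e| := by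
    have := abs_sub (p i - x i - s) e
    rw [show p i - x i - s - e = p i - (x i + e) - s by ring] at this
    linarith
  have hfin : |s + -(2 * e) - t| ≤ |p i - (x i + 2 * e) - t| + |p i - x i - s| := by
    have := abs_sub (p i - (x i + 2 * e) - t) (p i - x i - s)
    rwa [show p i - (x i + 2 * e) - t - (p i - x i - s) = s + -(2 * e) - t by ring] at this
  rw [hval]
  linarith

/-- Here one ball suffices: the drift at height `κ` is at most `κ * L`, and `κ * L + r ≤ ρ`. -/
lemma exists_mem_singlePatch {b : ι} (haI : a ∉ I) (h0 : (0 : ℝ) ∈ D) (h1 : (1 : ℝ) ∈ D)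
    (hp : AvoidsSums p D δ) (hδ : 0 < δ) (hδ1 : δ ≤ 1)
    (hC : C ≤ L * ((δ / 2) ^ 2) ^ Fintype.card ι) (hL1 : 1 ≤ L)
    (hh0 : 0 ≤ h) (hhδ : h ≤ δ / 4)
    (hκ0 : 0 ≤ κ) (hκδ : κ * L ≤ δ / 2) (hκη : κ * L ≤ η) (hκρ : κ * L + r ≤ ρ) (hr : r ≤ δ / 4)
    (hxS : x ∈ S) (hx : x ∈ Icc (0 : ι → ℝ) 1) (hxD : ∀ j, j ∉ I → x j ∈ D) (hxV : x ∈ V)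
    (hf : IsDual V.direction I a f) (hfC : ∀ i ∈ I, margin I x * |f i| ≤ C) :
    ∃ y ∈ V, y ∈ (Icc (0 : ι → ℝ) 1 ∩ Metric.cthickening η S) ∩ singlePatch I a b D p h κ ρ r S ∧
      (y = x ∨ ∀ i ∈ I, δ / 2 ≤ x i ∧ x i ≤ 1 - δ / 2) := by
  by_cases hfar : x ∈ farLevels p I (ballHeights D h b) r
  · exact ⟨x, hxV, ⟨⟨hx, Metric.self_subset_cthickening S hxS⟩, Or.inl ⟨hxS, hfar⟩⟩, Or.inl rfl⟩
  have hnear : ∀ i ∈ I, ∃ t ∈ ballHeights D h b i, |p i - x i - t| < r := by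
    simpa [farLevels] using hfar
  have hint : ∀ i ∈ I, δ / 2 ≤ x i ∧ x i ≤ 1 - δ / 2 := fun i hi => by
    obtain ⟨t, ht, htr⟩ := hnear i hi
    obtain ⟨s, hs, hst⟩ : ∃ s ∈ D, |t - s| ≤ h := by
      by_cases hib : i = b
      · subst hib
        simp only [ballHeights, Function.update_self, Finset.mem_image] at ht
        obtain ⟨s, hs, rfl⟩ := ht
        exact ⟨s, hs, (abs_shiftIn_sub hh0 s).le⟩
      · simp only [ballHeights, Function.update_of_ne hib] at ht
        exact ⟨t, ht, by simpa using hh0⟩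
    refine hp.interior (i := i) h0 h1 ⟨hx.1 i, hx.2 i⟩ hs ?_
    have := abs_add_le (p i - x i - t) (t - s)
    rw [show p i - x i - t + (t - s) = p i - x i - s by ring] at this
    linarith
  have hL : ∀ i ∈ I, |f i| ≤ L := fun i hi => slope_le_of_interior hδ hδ1 hC hfC hint hi
  have hκL : κ ≤ κ * L := le_mul_of_one_le_right hκ0 hL1
  obtain ⟨hV1, hK1, hlev1⟩ := shift_spec (η := η) haI hxS hx hxD hxV hf hL hL1 hκ0 (by linarith)
    hκδ hκη hint
  refine ⟨_, hV1, ⟨hK1, Or.inr ⟨hlev1, fun i hi => ?_⟩⟩, Or.inr hint⟩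
  obtain ⟨t, ht, htr⟩ := hnear i hi
  refine ⟨t, ht, ?_⟩
  have he : |inwardSign (x a) * κ * f i| ≤ κ * L := by
    rw [abs_mul, abs_mul, abs_inwardSign, one_mul, abs_of_nonneg hκ0]
    exact mul_le_mul_of_nonneg_left (hL i hi) hκ0
  have := abs_sub (p i - x i - t) (inwardSign (x a) * κ * f i)
  rw [show p i - x i - t - inwardSign (x a) * κ * f i
    = p i - (x + (inwardSign (x a) * κ) • f) i - t by simp; ring] at this
  linarith

end Hitting

/-! ### The perturbation step and the limit -/

section Construction

variable {ι : Type*} [Fintype ι] [DecidableEq ι]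

/-- Families of compact sets from which the construction can go on: up to finitely many heights,
`S I` is parallel to the coordinate subspace of `I`, and together they meet all subspaces. -/
structure Admissible (k : ℕ) (S : Finset ι → Set (ι → ℝ)) : Prop where
  isCompact : ∀ I, IsCompact (S I)
  subset : ∀ I, S I ⊆ Icc 0 1
  levels : ∃ D : Finset ℝ, 0 ∈ D ∧ 1 ∈ D ∧ (∀ t ∈ D, t ∈ Icc (0 : ℝ) 1) ∧
    ∀ I, ∀ x ∈ S I, ∀ j, j ∉ I → x j ∈ D
  hits : ∃ C, HitsWith k C S

/-- The union of the members of a family of the dimension complementary to `k`. -/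
def totalSet (k : ℕ) (S : Finset ι → Set (ι → ℝ)) : Set (ι → ℝ) :=
  ⋃ I ∈ {I : Finset ι | I.card + k = Fintype.card ι}, S I

omit [DecidableEq ι] in
lemma mem_totalSet {k : ℕ} {S : Finset ι → Set (ι → ℝ)} {x : ι → ℝ} :
    x ∈ totalSet k S ↔ ∃ I : Finset ι, I.card + k = Fintype.card ι ∧ x ∈ S I := by
  simp [totalSet]

omit [DecidableEq ι] in
lemma Admissible.isCompact_totalSet {k : ℕ} {S : Finset ι → Set (ι → ℝ)} (hS : Admissible k S) :
    IsCompact (totalSet k S) :=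
  (Set.toFinite _).isCompact_biUnion fun I _ => hS.isCompact I

lemma admissible_cubeFaces (k : ℕ) : Admissible k (cubeFaces (ι := ι)) where
  isCompact := isCompact_cubeFaces
  subset I x hx := hx.1
  levels := ⟨{0, 1}, by simp, by simp, by simp, fun I x hx j hj => by simpa using hx.2 j hj⟩
  hits := ⟨1, hitsWith_cubeFaces k⟩

lemma exists_pos_forall_le (F : Finset ℝ) (hF : ∀ x ∈ F, 0 < x) :
    ∃ δ : ℝ, 0 < δ ∧ δ ≤ 1 ∧ ∀ x ∈ F, δ ≤ x := by
  have hne : (insert 1 F).Nonempty := Finset.insert_nonempty _ _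
  refine ⟨(insert 1 F).min' hne, ?_, Finset.min'_le _ _ (by simp),
    fun x hx => Finset.min'_le _ _ (by simp [hx])⟩
  rw [Finset.lt_min'_iff]
  intro y hy
  rcases Finset.mem_insert.1 hy with rfl | hy
  · exact one_pos
  · exact hF y hy

omit [DecidableEq ι] in
lemma exists_avoidsSums (D : Finset ℝ) {O : Set (ι → ℝ)} (hO : IsOpen O) (hne : O.Nonempty) :
    ∃ p ∈ O, ∃ δ : ℝ, 0 < δ ∧ δ ≤ 1 ∧ AvoidsSums p D δ ∧ Separated D δ := by
  let F : Finset ℝ := (D ×ˢ D).image fun q => q.1 + q.2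
  have hdense : Dense (univ.pi fun _ : ι => ((F : Set ℝ)ᶜ)) :=
    dense_pi univ fun _ _ => F.countable_toSet.dense_compl ℝ
  obtain ⟨p, hpO, hp⟩ := hdense.inter_open_nonempty O hO hne
  have hp' : ∀ i, ∀ s ∈ D, ∀ t ∈ D, p i - s - t ≠ 0 := by
    intro i s hs t ht h
    refine hp i (mem_univ i) ?_
    simp only [F, Finset.coe_image, mem_image, Finset.mem_coe, Finset.mem_product]
    exact ⟨(s, t), ⟨hs, ht⟩, by simp; linarith⟩
  obtain ⟨δ₁, hδ₁, hδ₁1, h₁⟩ := exists_pos_forall_le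
    ((Finset.univ ×ˢ (D ×ˢ D)).image fun q : ι × ℝ × ℝ => |p q.1 - q.2.1 - q.2.2|) (by
      intro x hx
      obtain ⟨⟨i, s, t⟩, hq, rfl⟩ := Finset.mem_image.1 hx
      simp only [Finset.mem_product] at hq
      exact abs_pos.2 (hp' i s hq.2.1 t hq.2.2))
  obtain ⟨δ₂, hδ₂, hδ₂1, h₂⟩ := exists_pos_forall_le
    (((D ×ˢ D).filter fun q => q.1 ≠ q.2).image fun q : ℝ × ℝ => |q.1 - q.2|) (by
      intro x hx
      obtain ⟨⟨s, t⟩, hq, rfl⟩ := Finset.mem_image.1 hx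
      simp only [Finset.mem_filter] at hq
      exact abs_pos.2 (sub_ne_zero.2 hq.2))
  refine ⟨p, hpO, min δ₁ δ₂, lt_min hδ₁ hδ₂, (min_le_left _ _).trans hδ₁1, ?_, ?_⟩
  · intro i s hs t ht
    exact (min_le_left _ _).trans (h₁ _ (Finset.mem_image.2 ⟨(i, s, t), by simp [hs, ht], rfl⟩))
  · intro s hs t ht hst
    exact (min_le_right _ _).trans
      (h₂ _ (Finset.mem_image.2 ⟨(s, t), by simp [hs, ht, hst], rfl⟩))

/-- An admissible family can be perturbed slightly so that its sumset misses a point of a given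
open set. -/
lemma Admissible.exists_perturbation {k : ℕ} (hk0 : 0 < k) (hkd : k < Fintype.card ι)
    (hk : Fintype.card ι ≤ 2 * k) {S : Finset ι → Set (ι → ℝ)} (hS : Admissible k S)
    {η : ℝ} (hη : 0 < η) {O : Set (ι → ℝ)} (hO : IsOpen O) (hne : O.Nonempty) :
    ∃ S', Admissible k S' ∧ (∀ I, S' I ⊆ Metric.cthickening η (S I)) ∧
      ∃ p ∈ O, p ∉ totalSet k S' + totalSet k S' := by
  obtain ⟨D, h0, h1, hDI, hlev⟩ := hS.levels
  obtain ⟨C, hC⟩ := hS.hits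
  obtain ⟨p, hpO, δ, hδ, hδ1, hp, hsep⟩ := exists_avoidsSums D hO hne
  obtain ⟨o⟩ : Nonempty ι := Fintype.card_pos_iff.1 (by omega)
  -- One choice of height coordinate for all `I`, since the patch of `S I` also refers to that of
  -- `Iᶜ`.
  have : ∀ I : Finset ι, ∃ a, I ≠ Finset.univ → a ∉ I := fun I => by
    by_cases h : I = Finset.univ
    · exact ⟨o, fun h' => absurd h h'⟩
    · obtain ⟨a, ha⟩ := not_forall.1 (mt Finset.eq_univ_iff_forall.2 h)
      exact ⟨a, fun _ => ha⟩
  choose pick hpick using this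
  have hout : ∀ I : Finset ι, I.card + k = Fintype.card ι → pick I ∉ I := fun I hI =>
    hpick I (by rintro rfl; simp at hI; omega)
  have hin : ∀ I : Finset ι, I.card + k = Fintype.card ι → pick Iᶜ ∈ I := fun I hI => by
    have := hpick Iᶜ (by
      intro h
      have h' : I = ∅ := by simpa using h
      simp [h'] at hI; omega)
    simpa using this
  -- `c` bounds `margin` below at the holes, so `L` bounds the slopes there.
  set c := ((δ / 2) ^ 2) ^ Fintype.card ι with hc
  have hc0 : 0 < c := by positivity
  obtain ⟨L, hL1, hCL⟩ : ∃ L : ℝ, 1 ≤ L ∧ C ≤ L * c :=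
    ⟨max 1 (C / c), le_max_left _ _, (div_le_iff₀ hc0).1 (le_max_right _ _)⟩
  obtain ⟨h, hh0, hhδ, hhη⟩ : ∃ h : ℝ, 0 < h ∧ 2 * h * L ≤ δ / 4 ∧ 2 * h * L ≤ η := by
    have hm : 0 < min δ η := lt_min hδ hη
    refine ⟨min δ η / (8 * L), by positivity, ?_, ?_⟩ <;>
    · rw [show 2 * (min δ η / (8 * L)) * L = min δ η / 4 by field_simp; norm_num]
      linarith [min_le_left δ η, min_le_right δ η]
  obtain ⟨κ, hκ0, hκL⟩ : ∃ κ : ℝ, 0 < κ ∧ κ * L = h / 4 :=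
    ⟨h / (4 * L), by positivity, by field_simp⟩
  have hκh : κ ≤ κ * L := le_mul_of_one_le_right hκ0.le hL1
  have hhL : h ≤ h * L := le_mul_of_one_le_right hh0.le hL1
  -- The fixed coordinate `o` breaks the symmetry: exactly one of `I` and `Iᶜ` contains it and gets
  -- the double patch.
  let S' : Finset ι → Set (ι → ℝ) := fun I =>
    (Icc 0 1 ∩ Metric.cthickening η (S I)) ∩
      (if o ∈ I then doublePatch I (pick I) D p h (κ / 2) (κ / 6) (S I)
        else singlePatch I (pick I) (pick Iᶜ) D p h κ (h / 2) (h / 4) (S I))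
  let D' : Finset ℝ := D ∪ (D.image (shiftIn h) ∪ (D.image (shiftIn (2 * h)) ∪
    D.image (shiftIn κ)))
  have hlev' : ∀ I, ∀ x ∈ S' I, ∀ j, j ∉ I → x j ∈ D' := by
    have hshift : ∀ I z x, D.image (shiftIn z) ⊆ D' → x ∈ shiftedLevels I (pick I) D z →
        ∀ j, j ∉ I → x j ∈ D' := by
      intro I z x hz hx j hj
      by_cases hja : j = pick I
      · subst hja; exact hz hx.1
      · exact Finset.mem_union_left _ (hx.2 j hj hja)
    rintro I x ⟨-, hx⟩
    split_ifs at hx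
    · rcases hx with hx | hx | hx
      · exact fun j hj => Finset.mem_union_left _ (hlev I x hx.1 j hj)
      · exact hshift I h x (by intro t ht; simp only [D', Finset.mem_union]; tauto) hx.1
      · exact hshift I (2 * h) x (by intro t ht; simp only [D', Finset.mem_union]; tauto) hx.1
    · rcases hx with hx | hx
      · exact fun j hj => Finset.mem_union_left _ (hlev I x hx.1 j hj)
      · exact hshift I κ x (by intro t ht; simp only [D', Finset.mem_union]; tauto) hx.1
  have hD' : ∀ t ∈ D', t ∈ Icc (0 : ℝ) 1 ∧ ∃ s ∈ D, |t - s| ≤ 2 * h := by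
    have hshift : ∀ z, 0 ≤ z → z ≤ 2 * h → ∀ t ∈ D.image (shiftIn z),
        t ∈ Icc (0 : ℝ) 1 ∧ ∃ s ∈ D, |t - s| ≤ 2 * h := by
      intro z hz hzh t ht
      obtain ⟨s, hs, rfl⟩ := Finset.mem_image.1 ht
      exact ⟨shiftIn_mem hz (by linarith) (hDI s hs), s, hs, (abs_shiftIn_sub hz s).trans_le hzh⟩
    intro t ht
    simp only [D', Finset.mem_union] at ht
    rcases ht with ht | ht | ht | ht
    · exact ⟨hDI t ht, t, ht, by simp; linarith⟩
    · exact hshift h hh0.le (by linarith) t ht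
    · exact hshift (2 * h) (by linarith) le_rfl t ht
    · exact hshift κ hκ0.le (by linarith) t ht
  have hpatch : ∀ I J x y, o ∈ I → I.card + k = Fintype.card ι → J.card + k = Fintype.card ι →
      x ∈ S' I → y ∈ S' J → J = Iᶜ → x + y ≠ p := by
    rintro I _ x y ho hI hJ ⟨-, hx⟩ ⟨-, hy⟩ rfl
    rw [if_pos ho] at hx
    rw [if_neg (by simpa using ho), compl_compl] at hy
    exact add_ne_of_doublePatch_of_singlePatch (hout I hI) (hin I hI) hsep
      (fun y hy i hi => hlev _ y hy i (by simpa using hi)) (hlev I) (by positivity)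
      (by positivity) (by positivity) (by linarith) (by linarith) (by linarith) hh0.le
      (by linarith) hx hy
  refine ⟨S', ⟨fun I => ?_, fun I x hx => hx.1.1, ⟨D', by simp [D', h0], by simp [D', h1],
    fun t ht => (hD' t ht).1, hlev'⟩, ⟨max C L, ?_⟩⟩, fun I x hx => hx.1.2, p, hpO, ?_⟩
  · have hcl : IsClosed (S I) := (hS.isCompact I).isClosed
    refine isCompact_Icc.of_isClosed_subset ((isClosed_Icc.inter
      Metric.isClosed_cthickening).inter ?_) (fun x hx => hx.1.1)
    split_ifs
    · exact isClosed_doublePatch hcl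
    · exact isClosed_singlePatch hcl
  · intro V hVk hVne
    obtain ⟨I, hI, x, hxS, hxV, hdual⟩ := hC V hVk hVne
    have hx := hS.subset I hxS
    obtain ⟨f, hf, hfC⟩ := hdual (pick I) (hout I hI)
    obtain ⟨y, hyV, hyS, hyx⟩ : ∃ y ∈ V, y ∈ S' I ∧
        (y = x ∨ ∀ i ∈ I, δ / 2 ≤ x i ∧ x i ≤ 1 - δ / 2) := by
      by_cases ho : o ∈ I
      · simp only [S', if_pos ho]
        exact exists_mem_doublePatch (hout I hI) h0 h1 hsep hp hδ hδ1 hCL hL1 hh0 hhδ hhη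
          (by linarith) (by linarith) hxS hx (hlev I x hxS) hxV hf hfC
      · simp only [S', if_neg ho]
        exact exists_mem_singlePatch (hout I hI) h0 h1 hp hδ hδ1 hCL hL1 hh0.le
          (by linarith) hκ0.le (by linarith) (by linarith) (by linarith) (by linarith)
          hxS hx (hlev I x hxS) hxV hf hfC
    refine ⟨I, hI, y, hyS, hyV, fun j hj => ?_⟩
    obtain ⟨g, hg, hgC⟩ := hdual j hj
    -- Dual vectors depend only on `V` and `I`, so they survive the move from `x` to `y`. If the
    -- point moved, the slopes are at most `L` and the new margin is at most 1.
    refine ⟨g, hg, fun i hi => ?_⟩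
    rcases hyx with rfl | hint
    · exact (hgC i hi).trans (le_max_left _ _)
    · refine le_trans ?_ (le_max_right _ _)
      have h1 := slope_le_of_interior hδ hδ1 hCL hgC hint hi
      have h2 := mul_le_mul_of_nonneg_right (margin_le_one (I := I) hyS.1.1) (abs_nonneg (g i))
      linarith
  · rintro ⟨x, hx, y, hy, hxy⟩
    obtain ⟨I, hI, hx⟩ := mem_totalSet.1 hx
    obtain ⟨J, hJ, hy⟩ := mem_totalSet.1 hy
    change x + y = p at hxy
    by_cases hcov : ∃ l, l ∉ I ∧ l ∉ J
    · obtain ⟨l, hlI, hlJ⟩ := hcov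
      -- Two heights, each moved by at most `2 * h`, change the sum by at most `4 * h ≤ δ / 2 < δ`.
      obtain ⟨-, s, hs, hs'⟩ := hD' _ (hlev' I x hx l hlI)
      obtain ⟨-, t, ht, ht'⟩ := hD' _ (hlev' J y hy l hlJ)
      have h1 := hp l s hs t ht
      have h2 := abs_add_le (x l - s) (y l - t)
      rw [show x l - s + (y l - t) = p l - s - t by rw [← hxy]; simp; ring] at h2
      linarith
    · have hJI : J = Iᶜ := by
        symm
        refine Finset.eq_of_subset_of_card_le (fun l hl => ?_) ?_
        · by_contra h
          exact hcov ⟨l, by simpa using hl, h⟩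
        · rw [Finset.card_compl]; omega
      by_cases ho : o ∈ I
      · exact hpatch I J x y ho hI hJ hx hy hJI hxy
      · exact hpatch J I y x (by simpa [hJI] using ho) hJ hI hy hx (by simp [hJI])
          (by rw [add_comm]; exact hxy)

/-- A point outside the sumset of a compact set is outside that of a small thickening. -/
lemma exists_cthickening_notMem_add {E : Type*} [NormedAddCommGroup E] {U : Set E}
    (hU : IsCompact U) {p : E} (hp : p ∉ U + U) :
    ∃ η : ℝ, 0 < η ∧ p ∉ Metric.cthickening η U + Metric.cthickening η U := by
  obtain ⟨ε, hε, hball⟩ := Metric.isOpen_iff.1 (hU.add hU).isClosed.isOpen_compl p hp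
  refine ⟨ε / 4, by positivity, ?_⟩
  rintro ⟨x, hx, y, hy, rfl⟩
  rw [hU.cthickening_eq_biUnion_closedBall (by positivity)] at hx hy
  obtain ⟨u, hu, hxu⟩ := mem_iUnion₂.1 hx
  obtain ⟨v, hv, hyv⟩ := mem_iUnion₂.1 hy
  refine hball (?_ : u + v ∈ _) (add_mem_add hu hv)
  rw [Metric.mem_closedBall] at hxu hyv
  rw [Metric.mem_ball, dist_comm]
  have := dist_add_add_le x y u v
  change dist (x + y) (u + v) < ε
  linarith

theorem exists_compact_hitting {k : ℕ} (hk0 : 0 < k) (hkd : k < Fintype.card ι)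
    (hk : Fintype.card ι ≤ 2 * k) :
    ∃ K : Set (ι → ℝ), IsCompact K ∧ K ⊆ Icc 0 1 ∧
      (∀ V : AffineSubspace ℝ (ι → ℝ), finrank ℝ V.direction = k →
        ((V : Set (ι → ℝ)) ∩ Icc 0 1).Nonempty → ((V : Set (ι → ℝ)) ∩ K).Nonempty) ∧
      interior (K + K) = ∅ := by
  let B := TopologicalSpace.countableBasis (ι → ℝ)
  have hB := TopologicalSpace.isBasis_countableBasis (ι → ℝ)
  obtain ⟨O, hO⟩ : ∃ O : ℕ → Set (ι → ℝ), B = range O :=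
    (TopologicalSpace.countable_countableBasis _).exists_eq_range
      (by by_contra h
          rw [not_nonempty_iff_eq_empty] at h
          have := hB.sUnion_eq
          rw [show TopologicalSpace.countableBasis (ι → ℝ) = ∅ from h] at this
          simp at this
          exact empty_ne_univ this)
  have hOmem : ∀ n, O n ∈ B := fun n => hO ▸ mem_range_self n
  have hOopen : ∀ n, IsOpen (O n) := fun n => TopologicalSpace.isOpen_of_mem_countableBasis (hOmem n)
  have hOne : ∀ n, (O n).Nonempty := fun n =>
    TopologicalSpace.nonempty_of_mem_countableBasis (hOmem n)
  let State := {q : (Finset ι → Set (ι → ℝ)) × ℝ // Admissible k q.1 ∧ 0 < q.2}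
  let thick : State → Set (ι → ℝ) := fun q => Metric.cthickening q.1.2 (totalSet k q.1.1)
  have step : ∀ (n : ℕ) (q : State), ∃ q' : State, thick q' ⊆ thick q ∧
      ∃ p ∈ O n, p ∉ thick q' + thick q' := by
    rintro n ⟨⟨S, η⟩, hS, hη⟩
    obtain ⟨S', hS', hsub, p, hpO, hp⟩ :=
      hS.exists_perturbation hk0 hkd hk (half_pos hη) (hOopen n) (hOne n)
    obtain ⟨η', hη', hp'⟩ := exists_cthickening_notMem_add hS'.isCompact_totalSet hp
    -- `η / 2` for the perturbation plus `η / 2` for the thickening nests the new set in the old;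
    -- `η'` keeps `p` out of the sumset.
    refine ⟨⟨(S', min η' (η / 2)), hS', lt_min hη' (half_pos hη)⟩, ?_, p, hpO, fun hmem => hp' ?_⟩
    · have h1 : totalSet k S' ⊆ Metric.cthickening (η / 2) (totalSet k S) := by
        intro x hx
        obtain ⟨I, hI, hx⟩ := mem_totalSet.1 hx
        exact Metric.cthickening_subset_of_subset _
          (fun y hy => mem_totalSet.2 ⟨I, hI, hy⟩) (hsub I hx)
      calc Metric.cthickening (min η' (η / 2)) (totalSet k S')
          ⊆ Metric.cthickening (η / 2) (Metric.cthickening (η / 2) (totalSet k S)) :=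
            (Metric.cthickening_mono (min_le_right _ _) _).trans
              (Metric.cthickening_subset_of_subset _ h1)
        _ ⊆ Metric.cthickening (η / 2 + η / 2) (totalSet k S) :=
            Metric.cthickening_cthickening_subset (half_pos hη).le (half_pos hη).le _
        _ = Metric.cthickening η (totalSet k S) := by rw [add_halves]
    · have := Metric.cthickening_mono (min_le_left η' (η / 2)) (totalSet k S')
      exact add_subset_add this this hmem
  choose next hnext_sub hnext using step
  let q : ℕ → State := fun n =>
    Nat.rec ⟨(cubeFaces, 1), admissible_cubeFaces k, one_pos⟩ (fun n q => next n q) n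
  have hq : ∀ n, q (n + 1) = next n (q n) := fun n => rfl
  let T : ℕ → Set (ι → ℝ) := fun n => Icc 0 1 ∩ thick (q n)
  have hTcomp : ∀ n, IsCompact (T n) := fun n =>
    isCompact_Icc.inter_right Metric.isClosed_cthickening
  have hTanti : ∀ n, T (n + 1) ⊆ T n := fun n =>
    inter_subset_inter_right _ (by rw [hq]; exact hnext_sub n (q n))
  have hKcomp : IsCompact (⋂ n, T n) :=
    (hTcomp 0).of_isClosed_subset (isClosed_iInter fun n => (hTcomp n).isClosed)
      (iInter_subset T 0)
  refine ⟨⋂ n, T n, hKcomp, fun x hx => (mem_iInter.1 hx 0).1, fun V hVk hVne => ?_, ?_⟩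
  · have hVcl : IsClosed (V : Set (ι → ℝ)) := V.closed_of_finiteDimensional
    rw [inter_iInter]
    refine IsCompact.nonempty_iInter_of_sequence_nonempty_isCompact_isClosed _
      (fun n => inter_subset_inter_right _ (hTanti n)) (fun n => ?_)
      ((hTcomp 0).inter_left hVcl) (fun n => hVcl.inter (hTcomp n).isClosed)
    obtain ⟨C, hC⟩ := (q n).2.1.hits
    obtain ⟨I, hI, x, hxS, hxV, -⟩ := hC V hVk hVne
    exact ⟨x, hxV, (q n).2.1.subset I hxS,
      Metric.self_subset_cthickening _ (mem_totalSet.2 ⟨I, hI, hxS⟩)⟩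
  · by_contra hint
    obtain ⟨x, hx⟩ := nonempty_iff_ne_empty.2 hint
    obtain ⟨W, hW, -, hWsub⟩ := hB.exists_subset_of_mem_open hx isOpen_interior
    obtain ⟨n, rfl⟩ : W ∈ range O := hO ▸ hW
    obtain ⟨p, hpO, hp⟩ := hnext n (q n)
    refine hp ?_
    have hsub : (⋂ n, T n) ⊆ thick (next n (q n)) := fun y hy => (mem_iInter.1 hy (n + 1)).2
    exact add_subset_add hsub hsub (interior_subset (hWsub hpO))

end Construction

/-! ### Transfer to Euclidean space -/

theorem theoremt (d k : ℕ) (hd : 2 ≤ d) (hkd : k < d) (hk : (d : ℝ) / 2 ≤ (k : ℝ)) :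
    ∃ K : Set (EuclideanSpace ℝ (Fin d)),
      IsCompact K ∧
      K ⊆ unitCube d ∧
      (∀ V : AffineSubspace ℝ (EuclideanSpace ℝ (Fin d)),
        Module.finrank ℝ V.direction = k →
        ((V : Set (EuclideanSpace ℝ (Fin d))) ∩ unitCube d).Nonempty →
        ((V : Set (EuclideanSpace ℝ (Fin d))) ∩ K).Nonempty) ∧
      IsNowhereDense (K + K) := by
  have hk2 : d ≤ 2 * k := by
    have : (d : ℝ) ≤ 2 * k := by linarith
    exact_mod_cast this
  obtain ⟨K, hK, hKsub, hhit, hint⟩ := exists_compact_hitting (ι := Fin d) (k := k) (by omega)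
    (by simpa using hkd) (by simpa using hk2)
  let e := EuclideanSpace.equiv (Fin d) ℝ
  have hcube : ∀ x, x ∈ unitCube d ↔ e x ∈ Icc (0 : Fin d → ℝ) 1 := fun x =>
    ⟨fun h => ⟨fun i => (h i).1, fun i => (h i).2⟩, fun h i => ⟨h.1 i, h.2 i⟩⟩
  have hKE : IsCompact (e ⁻¹' K) := e.toHomeomorph.isCompact_preimage.2 hK
  refine ⟨e ⁻¹' K, hKE, fun x hx => (hcube x).2 (hKsub hx), fun V hVk hVne => ?_, ?_⟩
  · let φ : EuclideanSpace ℝ (Fin d) →ᵃ[ℝ] (Fin d → ℝ) := e.toLinearEquiv.toLinearMap.toAffineMap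
    obtain ⟨x, hxV, hx⟩ := hVne
    have hdir : finrank ℝ (V.map φ).direction = k := by
      rw [AffineSubspace.map_direction, ← hVk]
      exact LinearEquiv.finrank_map_eq e.toLinearEquiv V.direction
    obtain ⟨_, ⟨y, hyV, rfl⟩, hyK⟩ := hhit (V.map φ) hdir
      ⟨e x, ⟨x, hxV, rfl⟩, (hcube x).1 hx⟩
    exact ⟨y, hyV, hyK⟩
  · rw [IsNowhereDense, (hKE.add hKE).isClosed.closure_eq]
    have : e ⁻¹' K + e ⁻¹' K = e ⁻¹' (K + K) := by
      ext z
      constructor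
      · rintro ⟨x, hx, y, hy, rfl⟩
        exact ⟨e x, hx, e y, hy, (map_add e x y).symm⟩
      · rintro ⟨x, hx, y, hy, hxy⟩
        refine ⟨e.symm x, by simpa using hx, e.symm y, by simpa using hy, e.injective ?_⟩
        simpa using hxy
    rw [this]
    have h := e.toHomeomorph.preimage_interior (K + K)
    rw [hint] at h
    simpa using h.symm
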